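/- **Theorem.** For a homeomorphism $S$ of a compact Hausdorff space $X$ let $(C(X),\sigma)$ be the C*-algebra $C(X)$ of continuous functions $X\to\mathbb{C}$ with the automorphism $\sigma(f)=f\circ S$. Regard it as a metric structure of continuous first-order logic in the language of unital C*-algebras expanded by a unary function symbol for $\sigma$: terms are built from variables by $0$, $1$, $+$, $\cdot$, ${}^*$, multiplication by complex scalars, and $\sigma$; atomic formulas are $\|t\|$ and $d(s,t)=\|s-t\|$; connectives are the continuous functions $\mathbb{R}^k\to\mathbb{R}$; quantifiers are $\sup$ and $\inf$ over the closed balls of radius $r\in\mathbb{N}$ about $0$. Write $(C(X),\sigma)\equiv(C(Y),\tau)$ (elementary equivalence) if every sentence has the same value in both structures, and $(C(X),\sigma)\cong(C(Y),\tau)$ if there is a $*$-isomorphism $\Phi:C(X)\to C(Y)$ with $\Phi\circ\sigma=\tau\circ\Phi$. Given integers $a_n\ge 2$ ($n\ge 1$), let "addition of $1$ with carry" be the self-map of the product space $\prod_{n\ge1}\{0,\dots,a_n-1\}$ (with each factor discrete) that sends $(b_n)_{n\ge1}$ to $(0,\dots,0,b_n+1,b_{n+1},b_{n+2},\dots)$,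 where $n$ is the least index with $b_n<a_n-1$, and to $(0,0,0,\dots)$ if there is no such index. An *odometer* is a pair $(X,S)$ of a topological space (necessarily a Cantor set) and a homeomorphism $S:X\to X$ which is topologically conjugate to this map for some sequence $(a_n)_{n\geq 1}$ of integers $a_n\ge2$. Let $(X,S)$ and $(Y,T)$ be odometers, with induced automorphisms $\sigma$ of $C(X)$ and $\tau$ of $C(Y)$. Then $$(C(X),\sigma)\equiv(C(Y),\tau)\iff(C(X),\sigma)\cong(C(Y),\tau),$$ and likewise $(C(X),\sigma)\equiv(C(Y),\tau)$ if and only if $(X,S)$ and $(Y,T)$ are topologically conjugate, i.e. there is a homeomorphism $h:X\to Y$ with $h\circ S=T\circ h$. -/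

import Mathlib

open scoped Topology

noncomputable section

namespace CStarDyn

/-! ### Continuous logic for unital C⋆-algebras with an automorphism

The language has the function symbols of unital C⋆-algebras (`0`, `1`, addition, multiplication,
involution, scalar multiplication by each complex number) and one further unary function symbol `σ`,
the predicate symbols `‖·‖` and `d(·,·)`, and, as domains of quantification, the closed balls of
radius `r` about `0`, for each natural number `r`. -/

/-- Terms of the language in the free variables `x₀, …, xₙ₋₁`. -/
inductive Term (n : ℕ) : Type
  | var (i : Fin n) : Term n
  | zero : Term n
  | one : Term n
  | add (s t : Term n) : Term n
  | mul (s t : Term n) : Term n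
  | star (t : Term n) : Term n
  | smul (c : ℂ) (t : Term n) : Term n
  | sigma (t : Term n) : Term n

/-- Formulas of continuous logic in `n` free variables: atomic formulas, continuous functions
`ℝᵏ → ℝ` as connectives, and the quantifiers `sup` and `inf` over the ball of radius `r`.
A quantifier binds the variable with index `0` and shifts the others. -/
inductive Formula : ℕ → Type
  | norm {n : ℕ} (t : Term n) : Formula n
  | dist {n : ℕ} (s t : Term n) : Formula n
  | conn {n k : ℕ} (u : C(Fin k → ℝ, ℝ)) (φ : Fin k → Formula n) : Formula n
  | sup {n : ℕ} (r : ℕ) (φ : Formula (n + 1)) : Formula n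
  | inf {n : ℕ} (r : ℕ) (φ : Formula (n + 1)) : Formula n

/-- Sentences are formulas without free variables. -/
abbrev Sentence : Type := Formula 0

section Semantics

variable {A : Type*} [CStarAlgebra A]

/-- The interpretation of a term in `(A, σ)`. -/
def Term.eval (σ : A ≃⋆ₐ[ℂ] A) {n : ℕ} (v : Fin n → A) : Term n → A
  | .var i => v i
  | .zero => 0
  | .one => 1
  | .add s t => s.eval σ v + t.eval σ v
  | .mul s t => s.eval σ v * t.eval σ v
  | .star t => Star.star (t.eval σ v)
  | .smul c t => c • t.eval σ v
  | .sigma t => σ (t.eval σ v)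

/-- The (real) value of a formula in `(A, σ)`. -/
def Formula.eval (σ : A ≃⋆ₐ[ℂ] A) : {n : ℕ} → Formula n → (Fin n → A) → ℝ
  | _, .norm t, v => ‖t.eval σ v‖
  | _, .dist s t, v => Dist.dist (s.eval σ v) (t.eval σ v)
  | _, .conn u φ, v => u fun i => (φ i).eval σ v
  | n, .sup r φ, v =>
      ⨆ x : Metric.closedBall (0 : A) r, φ.eval σ (Fin.cons (x : A) v : Fin (n + 1) → A)
  | n, .inf r φ, v =>
      ⨅ x : Metric.closedBall (0 : A) r, φ.eval σ (Fin.cons (x : A) v : Fin (n + 1) → A)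

/-- A term is bounded on bounded tuples. -/
theorem Term.exists_bound (σ : A ≃⋆ₐ[ℂ] A) {n : ℕ} (R : ℝ) (t : Term n) :
    ∃ C : ℝ, ∀ v : Fin n → A, (∀ i, ‖v i‖ ≤ R) → ‖t.eval σ v‖ ≤ C := by
  induction t with
  | var i => exact ⟨R, fun v hv => hv i⟩
  | zero => exact ⟨0, fun v _ => by simp [Term.eval]⟩
  | one => exact ⟨‖(1 : A)‖, fun v _ => le_rfl⟩
  | add s t hs ht =>
    obtain ⟨C, hC⟩ := hs
    obtain ⟨D, hD⟩ := ht
    exact ⟨C + D, fun v hv => (norm_add_le _ _).trans (add_le_add (hC v hv) (hD v hv))⟩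
  | mul s t hs ht =>
    obtain ⟨C, hC⟩ := hs
    obtain ⟨D, hD⟩ := ht
    exact ⟨C * D, fun v hv => (norm_mul_le _ _).trans
      (mul_le_mul (hC v hv) (hD v hv) (norm_nonneg _) ((norm_nonneg _).trans (hC v hv)))⟩
  | star t ht =>
    obtain ⟨C, hC⟩ := ht
    exact ⟨C, fun v hv => by simpa [Term.eval] using hC v hv⟩
  | smul c t ht =>
    obtain ⟨C, hC⟩ := ht
    exact ⟨‖c‖ * C, fun v hv => (norm_smul_le _ _).trans
      (mul_le_mul_of_nonneg_left (hC v hv) (norm_nonneg _))⟩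
  | sigma t ht =>
    obtain ⟨C, hC⟩ := ht
    exact ⟨C, fun v hv => (NonUnitalStarAlgHom.norm_apply_le σ _).trans (hC v hv)⟩

/-- A formula is bounded on bounded tuples; so the suprema and infima in `Formula.eval` are always
taken over nonempty bounded sets of reals. -/
theorem Formula.exists_bound (σ : A ≃⋆ₐ[ℂ] A) {n : ℕ} (φ : Formula n) :
    ∀ R : ℝ, ∃ C : ℝ, ∀ v : Fin n → A, (∀ i, ‖v i‖ ≤ R) → |φ.eval σ v| ≤ C := by
  have key : ∀ {n : ℕ} (r : ℕ) (R : ℝ) (v : Fin n → A), (∀ i, ‖v i‖ ≤ R) →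
      ∀ x : Metric.closedBall (0 : A) r, ∀ i,
        ‖(Fin.cons (x : A) v : Fin (n + 1) → A) i‖ ≤ max (r : ℝ) R := by
    intro n r R v hv x i
    refine Fin.cases ?_ (fun j => ?_) i
    · exact le_max_of_le_left (mem_closedBall_zero_iff.1 x.2)
    · exact le_max_of_le_right (by simpa using hv j)
  have hne : ∀ r : ℕ, Nonempty (Metric.closedBall (0 : A) r) := fun r =>
    ⟨⟨0, by simp⟩⟩
  induction φ with
  | norm t =>
    intro R
    obtain ⟨C, hC⟩ := t.exists_bound σ R
    exact ⟨C, fun v hv => by simpa [Formula.eval] using hC v hv⟩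
  | dist s t =>
    intro R
    obtain ⟨C, hC⟩ := s.exists_bound σ R
    obtain ⟨D, hD⟩ := t.exists_bound σ R
    refine ⟨C + D, fun v hv => ?_⟩
    simp only [Formula.eval, dist_eq_norm, abs_norm]
    exact (norm_sub_le _ _).trans (add_le_add (hC v hv) (hD v hv))
  | @conn n k u φ ih =>
    intro R
    choose C hC using fun i => ih i R
    obtain ⟨D, hD⟩ := (isCompact_univ_pi fun i : Fin k =>
      isCompact_Icc (a := -C i) (b := C i)).exists_bound_of_continuousOn u.continuous.continuousOn
    exact ⟨D, fun v hv => hD _ fun i _ => abs_le.1 (hC i v hv)⟩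
  | sup r φ ih =>
    intro R
    obtain ⟨C, hC⟩ := ih (max (r : ℝ) R)
    refine ⟨C, fun v hv => ?_⟩
    have h := fun x => abs_le.1 (hC _ (key r R v hv x))
    have := hne r
    exact abs_le.2 ⟨(h (hne r).some).1.trans
      (le_ciSup (f := fun x : Metric.closedBall (0 : A) r => φ.eval σ (Fin.cons (x : A) v))
        ⟨C, by rintro _ ⟨x, rfl⟩; exact (h x).2⟩ _), ciSup_le fun x => (h x).2⟩
  | inf r φ ih =>
    intro R
    obtain ⟨C, hC⟩ := ih (max (r : ℝ) R)
    refine ⟨C, fun v hv => ?_⟩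
    have h := fun x => abs_le.1 (hC _ (key r R v hv x))
    have := hne r
    exact abs_le.2 ⟨le_ciInf fun x => (h x).1,
      (ciInf_le (f := fun x : Metric.closedBall (0 : A) r => φ.eval σ (Fin.cons (x : A) v))
        ⟨-C, by rintro _ ⟨x, rfl⟩; exact (h x).1⟩ _).trans (h (hne r).some).2⟩

/-- Elementary equivalence `(A, σ) ≡ (B, τ)`: every sentence has the same value in both. -/
def ElementarilyEquivalent {B : Type*} [CStarAlgebra B]
    (σ : A ≃⋆ₐ[ℂ] A) (τ : B ≃⋆ₐ[ℂ] B) : Prop :=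
  ∀ φ : Sentence, φ.eval σ Fin.elim0 = φ.eval τ Fin.elim0

/-- Isomorphism `(A, σ) ≅ (B, τ)`: a (necessarily isometric) `⋆`-isomorphism intertwining the
automorphisms. -/
def Isomorphic {B : Type*} [CStarAlgebra B]
    (σ : A ≃⋆ₐ[ℂ] A) (τ : B ≃⋆ₐ[ℂ] B) : Prop :=
  ∃ Φ : A ≃⋆ₐ[ℂ] B, ∀ a : A, Φ (σ a) = τ (Φ a)

end Semantics

/-- The automorphism `f ↦ f ∘ S` of `C(X)` induced by a homeomorphism `S` of `X`. -/
def inducedAut {X : Type*} [TopologicalSpace X] (S : X ≃ₜ X) : C(X, ℂ) ≃⋆ₐ[ℂ] C(X, ℂ) :=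
  S.compStarAlgEquiv' ℂ ℂ

theorem inducedAut_apply {X : Type*} [TopologicalSpace X] (S : X ≃ₜ X) (f : C(X, ℂ)) (x : X) :
    inducedAut S f x = f (S x) := rfl

/-! ### Odometers -/

/-- Topological conjugacy of two homeomorphisms. -/
def TopConjugate {X Y : Type*} [TopologicalSpace X] [TopologicalSpace Y]
    (S : X ≃ₜ X) (T : Y ≃ₜ Y) : Prop :=
  ∃ h : X ≃ₜ Y, ∀ x : X, h (S x) = T (h x)

/-- Addition of `1` at the leftmost digit, with carry to the right, on `∏ₙ {0, …, aₙ - 1}`: the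
`k`-th digit is changed exactly if all digits before it are maximal, and then it is increased by one
modulo `aₖ`. -/
def odometerMap (a : ℕ → ℕ) (b : ∀ n, Fin (a n)) : ∀ n, Fin (a n) := fun k =>
  ⟨if ∀ j < k, (b j : ℕ) + 1 = a j then ((b k : ℕ) + 1) % a k else b k, by
    have hk := (b k).isLt
    split_ifs
    · exact Nat.mod_lt _ (by omega)
    · exact hk⟩

/-- If `n` is the first index with `bₙ < aₙ - 1`, the image of `b` is
`(0, …, 0, bₙ + 1, bₙ₊₁, …)`. -/
theorem odometerMap_of_first {a : ℕ → ℕ} {b : ∀ n, Fin (a n)} {n : ℕ}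
    (h : ∀ j < n, (b j : ℕ) + 1 = a j) (hn : (b n : ℕ) + 1 < a n) (k : ℕ) :
    (odometerMap a b k : ℕ) = if k < n then 0 else if k = n then (b n : ℕ) + 1 else b k := by
  rcases lt_trichotomy k n with hk | rfl | hk
  · have h1 : ∀ j < k, (b j : ℕ) + 1 = a j := fun j hj => h j (hj.trans hk)
    simp only [odometerMap]
    rw [if_pos h1, if_pos hk, h k hk, Nat.mod_self]
  · simp only [odometerMap]
    rw [if_pos h, if_neg (lt_irrefl _), Nat.mod_eq_of_lt hn, if_pos trivial]
  · have h1 : ¬ ∀ j < k, (b j : ℕ) + 1 = a j := fun H => by have := H n hk; omega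
    simp only [odometerMap]
    rw [if_neg h1, if_neg (by omega), if_neg (by omega)]

/-- If all digits of `b` are maximal, its image is `(0, 0, 0, …)`. -/
theorem odometerMap_of_all {a : ℕ → ℕ} {b : ∀ n, Fin (a n)}
    (h : ∀ j, (b j : ℕ) + 1 = a j) (k : ℕ) : (odometerMap a b k : ℕ) = 0 := by
  simp only [odometerMap]
  rw [if_pos fun j _ => h j, h k, Nat.mod_self]

/-- `(X, S)` is an odometer: it is topologically conjugate to addition of `1` with carry on
`∏ₙ {0, …, aₙ - 1}` (product of discrete spaces) for some sequence of integers `aₙ ≥ 2`.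
In particular `X` is then a Cantor set. -/
def IsOdometer {X : Type*} [TopologicalSpace X] (S : X ≃ₜ X) : Prop :=
  ∃ a : ℕ → ℕ, (∀ n, 2 ≤ a n) ∧
    ∃ h : X ≃ₜ (∀ n, Fin (a n)), ∀ x : X, h (S x) = odometerMap a (h x)

end CStarDyn

end

namespace CStarDyn

open Filter Finset

/-! ### Isomorphic structures are elementarily equivalent -/

section Isomorphism

variable {A B : Type*} [CStarAlgebra A] [CStarAlgebra B]

/-! Conjugacy gives isomorphism by composition, and isomorphism gives elementary equivalence by
induction on formulas. It remains to recover an odometer up to conjugacy from its theory.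

The invariant is the set of `d` dividing some partial product `a 0 * ... * a (n-1)`. It is read off
from sentences: `d` lies in it exactly when a primitive `d`-th root of unity `z` makes
`eigenvalueSentence d z` vanish. If `d` divides a partial product, `z` raised to the number formed
by the first digits is an eigenfunction. Conversely, approximate eigenfunctions can be rounded to
values in the `d`-th roots of unity, and recurrence of a point then forces the divisibility
(`exists_dvd_of_eval_eigenvalueSentence`).

The invariant determines the odometer: recording the residues of a point modulo all these `d` embeds
the system into `ℕ → ℕ`, with image (`range_residues`) and dynamics (`residues_odometerMap`)
depending on the set alone. -/

theorem Term.eval_map {σ : A ≃⋆ₐ[ℂ] A} {τ : B ≃⋆ₐ[ℂ] B} (Φ : A ≃⋆ₐ[ℂ] B)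
    (hΦ : ∀ a, Φ (σ a) = τ (Φ a)) {n : ℕ} (t : Term n) (v : Fin n → A) :
    t.eval τ (fun i => Φ (v i)) = Φ (t.eval σ v) := by
  induction t with
  | var i => rfl
  | zero => simp [Term.eval]
  | one => simp [Term.eval]
  | add s t hs ht => simp [Term.eval, hs, ht]
  | mul s t hs ht => simp [Term.eval, hs, ht]
  | star t ht => simp [Term.eval, ht, map_star]
  | smul c t ht => simp [Term.eval, ht]
  | sigma t ht => simp [Term.eval, ht, hΦ]

/-- A `⋆`-isomorphism restricts to a bijection of closed balls about `0`. -/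
def ballEquiv (Φ : A ≃⋆ₐ[ℂ] B) (r : ℝ) :
    Metric.closedBall (0 : A) r ≃ Metric.closedBall (0 : B) r :=
  Φ.toEquiv.subtypeEquiv fun a => by
    rw [mem_closedBall_zero_iff, mem_closedBall_zero_iff]
    exact (congrArg (· ≤ r) (StarAlgEquiv.norm_map Φ a)).symm.to_iff

theorem coe_ballEquiv (Φ : A ≃⋆ₐ[ℂ] B) (r : ℝ) (x : Metric.closedBall (0 : A) r) :
    (ballEquiv Φ r x : B) = Φ x := rfl

theorem Formula.eval_map {σ : A ≃⋆ₐ[ℂ] A} {τ : B ≃⋆ₐ[ℂ] B} (Φ : A ≃⋆ₐ[ℂ] B)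
    (hΦ : ∀ a, Φ (σ a) = τ (Φ a)) {n : ℕ} (φ : Formula n) (v : Fin n → A) :
    φ.eval τ (fun i => Φ (v i)) = φ.eval σ v := by
  have cons : ∀ {n : ℕ} (v : Fin n → A) (x : A),
      (Fin.cons (Φ x) (fun i => Φ (v i)) : Fin (n + 1) → B) =
        fun i => Φ ((Fin.cons x v : Fin (n + 1) → A) i) := by
    intro n v x
    funext i
    refine Fin.cases ?_ (fun j => ?_) i <;> simp
  induction φ with
  | norm t =>
    simp only [Formula.eval, Term.eval_map Φ hΦ]
    exact StarAlgEquiv.norm_map Φ _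
  | dist s t =>
    simp only [Formula.eval, Term.eval_map Φ hΦ, dist_eq_norm, ← map_sub]
    exact StarAlgEquiv.norm_map Φ _
  | conn u φ ih => simp only [Formula.eval, ih]
  | sup r φ ih =>
    simp only [Formula.eval]
    rw [← (ballEquiv Φ r).iSup_comp]
    simp only [coe_ballEquiv, cons, ih]
  | inf r φ ih =>
    simp only [Formula.eval]
    rw [← (ballEquiv Φ r).iInf_comp]
    simp only [coe_ballEquiv, cons, ih]

theorem Isomorphic.elementarilyEquivalent {σ : A ≃⋆ₐ[ℂ] A} {τ : B ≃⋆ₐ[ℂ] B}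
    (h : Isomorphic σ τ) : ElementarilyEquivalent σ τ := by
  obtain ⟨Φ, hΦ⟩ := h
  intro φ
  rw [← Formula.eval_map Φ hΦ φ]
  congr 1
  exact Subsingleton.elim _ _

end Isomorphism

theorem TopConjugate.isomorphic {X Y : Type*} [TopologicalSpace X] [CompactSpace X]
    [TopologicalSpace Y] [CompactSpace Y] {S : X ≃ₜ X} {T : Y ≃ₜ Y} (h : TopConjugate S T) :
    Isomorphic (inducedAut S) (inducedAut T) := by
  obtain ⟨h, hh⟩ := h
  refine ⟨h.symm.compStarAlgEquiv' ℂ ℂ, fun f => ContinuousMap.ext fun y => ?_⟩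
  change f (S (h.symm y)) = f (h.symm (T y))
  rw [← h.apply_symm_apply y, ← hh, h.symm_apply_apply, h.symm_apply_apply]

/-! ### The sentence expressing that a root of unity is an eigenvalue -/

/-- The power `t ^ d` of a term. -/
def Term.pow {n : ℕ} (t : Term n) : ℕ → Term n
  | 0 => .one
  | d + 1 => .mul (Term.pow t d) t

/-- The sentence `inf_u (‖u ^ d - 1‖ + ‖σ u - z u‖)`, with `u` in the unit ball. -/
def eigenvalueSentence (d : ℕ) (z : ℂ) : Sentence :=
  .inf 1 (.conn ⟨fun v : Fin 2 → ℝ => v 0 + v 1, by fun_prop⟩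
    ![.dist (Term.pow (.var 0) d) .one, .dist (.sigma (.var 0)) (.smul z (.var 0))])

section Eigenvalue

variable {A : Type*} [CStarAlgebra A]

theorem Term.eval_pow (σ : A ≃⋆ₐ[ℂ] A) {n : ℕ} (v : Fin n → A) (t : Term n) (d : ℕ) :
    (Term.pow t d).eval σ v = t.eval σ v ^ d := by
  induction d with
  | zero => simp [Term.pow, Term.eval]
  | succ d ih => simp [Term.pow, Term.eval, ih, pow_succ]

theorem eval_eigenvalueSentence (σ : A ≃⋆ₐ[ℂ] A) (d : ℕ) (z : ℂ) :
    (eigenvalueSentence d z).eval σ Fin.elim0 =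
      ⨅ u : Metric.closedBall (0 : A) ((1 : ℕ) : ℝ),
        (‖(u : A) ^ d - 1‖ + ‖σ (u : A) - z • (u : A)‖) := by
  simp [eigenvalueSentence, Formula.eval, Term.eval, Term.eval_pow, dist_eq_norm]

theorem eval_eigenvalueSentence_eq_zero {σ : A ≃⋆ₐ[ℂ] A} {d : ℕ} {z : ℂ} {u : A}
    (hu : ‖u‖ ≤ 1) (hd : u ^ d = 1) (hz : σ u = z • u) :
    (eigenvalueSentence d z).eval σ Fin.elim0 = 0 := by
  rw [eval_eigenvalueSentence]
  have hmem : u ∈ Metric.closedBall (0 : A) ((1 : ℕ) : ℝ) := by simpa using hu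
  have : Nonempty (Metric.closedBall (0 : A) ((1 : ℕ) : ℝ)) := ⟨⟨u, hmem⟩⟩
  refine le_antisymm (ciInf_le_of_le ⟨0, ?_⟩ ⟨u, hmem⟩ (by simp [hd, hz]))
    (le_ciInf fun _ => by positivity)
  rintro _ ⟨x, rfl⟩
  positivity

theorem exists_of_eval_eigenvalueSentence {σ : A ≃⋆ₐ[ℂ] A} {d : ℕ} {z : ℂ}
    (h : (eigenvalueSentence d z).eval σ Fin.elim0 = 0) {ε : ℝ} (hε : 0 < ε) :
    ∃ u : A, ‖u ^ d - 1‖ < ε ∧ ‖σ u - z • u‖ < ε := by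
  rw [eval_eigenvalueSentence] at h
  have : Nonempty (Metric.closedBall (0 : A) ((1 : ℕ) : ℝ)) := ⟨⟨0, by simp⟩⟩
  obtain ⟨u, hu⟩ := exists_lt_of_ciInf_lt (h.trans_lt hε)
  exact ⟨u, (le_add_of_nonneg_right (norm_nonneg _)).trans_lt hu,
    (le_add_of_nonneg_left (norm_nonneg _)).trans_lt hu⟩

end Eigenvalue

/-- Distinct `d`-th roots of unity are uniformly separated. -/
theorem exists_rootsOfUnity_gap {d : ℕ} (hd : 0 < d) :
    ∃ c : ℝ, 0 < c ∧ ∀ z w : ℂ, z ^ d = 1 → w ^ d = 1 → ‖z - w‖ < c → z = w := by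
  have hfin : {z : ℂ | z ^ d = 1}.Finite := by
    refine (Polynomial.nthRoots d (1 : ℂ)).toFinset.finite_toSet.subset fun z hz => ?_
    simpa [Polynomial.mem_nthRoots hd] using hz
  -- The nonzero distances between roots form a finite, hence closed, set missing `0`, so some ball
  -- about `0` avoids it.
  obtain ⟨c, hc, h⟩ := ((hfin.prod hfin).image fun p => ‖p.1 - p.2‖).subset
    (Set.sdiff_subset (t := {0})) |>.isClosed.isOpen_compl.mem_nhds
      (show (0 : ℝ) ∈ _ by simp) |> Metric.mem_nhds_iff.1
  refine ⟨c, hc, fun z w hz hw hzw => ?_⟩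
  by_contra hne
  refine h (show ‖z - w‖ ∈ Metric.ball (0 : ℝ) c by simpa using hzw) ⟨⟨(z, w), ⟨hz, hw⟩, rfl⟩, ?_⟩
  simpa [sub_eq_zero] using hne

/-- A number whose `d`-th power is close to `1` is close to a `d`-th root of unity. -/
theorem exists_rootOfUnity_near {d : ℕ} (hd : 0 < d) {η : ℝ} (hη : 0 ≤ η) {w : ℂ}
    (hw : ‖w ^ d - 1‖ < η ^ d) : ∃ ζ : ℂ, ζ ^ d = 1 ∧ ‖w - ζ‖ < η := by
  by_contra! h
  have hprim := Complex.isPrimitiveRoot_exp d hd.ne'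
  -- If all `d` factors had modulus at least `η`, the product would have modulus at least `η ^ d`.
  have key : w ^ d - 1 = ∏ ζ ∈ Polynomial.nthRootsFinset d (1 : ℂ), (w - ζ) := by
    have := congrArg (Polynomial.eval w) (Polynomial.X_pow_sub_one_eq_prod hd hprim)
    simpa [Polynomial.eval_prod] using this
  have hle : η ^ d ≤ ‖w ^ d - 1‖ := by
    calc η ^ d = ∏ _ζ ∈ Polynomial.nthRootsFinset d (1 : ℂ), η := by
          rw [Finset.prod_const, hprim.card_nthRootsFinset]
      _ ≤ ∏ ζ ∈ Polynomial.nthRootsFinset d (1 : ℂ), ‖w - ζ‖ :=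
          Finset.prod_le_prod (fun _ _ => hη)
            fun ζ hζ => h ζ ((Polynomial.mem_nthRootsFinset hd _).1 hζ)
      _ = ‖w ^ d - 1‖ := by rw [key, norm_prod]
  exact absurd hw hle.not_gt

/-- If `S ^ N n` tends to the identity at a point and the primitive `d`-th root of unity `z` is an
approximate eigenvalue as in `eigenvalueSentence`, then `d` divides some `N n`. -/
theorem exists_dvd_of_eval_eigenvalueSentence {X : Type*} [TopologicalSpace X] [CompactSpace X]
    {S : X ≃ₜ X} {d : ℕ} (hd : 0 < d) {z : ℂ} (hz : IsPrimitiveRoot z d)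
    (h : (eigenvalueSentence d z).eval (inducedAut S) Fin.elim0 = 0) {N : ℕ → ℕ} {x : X}
    (hN : Tendsto (fun n => S^[N n] x) atTop (𝓝 x)) : ∃ n, d ∣ N n := by
  obtain ⟨c, hc, hgap⟩ := exists_rootsOfUnity_gap hd
  have hη : 0 < c / 3 := by positivity
  obtain ⟨u, hu1, hu2⟩ := exists_of_eval_eigenvalueSentence h
    (lt_min hη (pow_pos hη d))
  -- Round `u` pointwise to roots of unity. Errors below `c / 3` make each comparison below a sum of
  -- three terms, hence below the gap `c`, so approximate identities become exact. Continuity of `ζ`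
  -- is never needed.
  have hpt : ∀ y, ∃ ζ : ℂ, ζ ^ d = 1 ∧ ‖u y - ζ‖ < c / 3 := fun y => by
    refine exists_rootOfUnity_near hd hη.le (lt_of_le_of_lt ?_ (hu1.trans_le (min_le_right _ _)))
    exact (u ^ d - 1).norm_coe_le_norm y
  choose ζ hζ1 hζ2 using hpt
  have hz1 : ‖z‖ = 1 := hz.norm'_eq_one hd.ne'
  have hstep : ∀ y, ζ (S y) = z * ζ y := fun y => by
    refine hgap _ _ (hζ1 _) (by rw [mul_pow, hz.pow_eq_one, hζ1, one_mul]) ?_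
    have h1 : ‖u (S y) - z * u y‖ < c / 3 :=
      lt_of_le_of_lt ((inducedAut S u - z • u).norm_coe_le_norm y)
        (hu2.trans_le (min_le_left _ _))
    have h2 : ‖z * (u y - ζ y)‖ < c / 3 := by rw [norm_mul, hz1, one_mul]; exact hζ2 y
    have h3 : ‖ζ (S y) - u (S y)‖ < c / 3 := by rw [norm_sub_rev]; exact hζ2 _
    calc ‖ζ (S y) - z * ζ y‖
        = ‖(ζ (S y) - u (S y)) + (u (S y) - z * u y) + z * (u y - ζ y)‖ := by ring_nf
      _ ≤ ‖ζ (S y) - u (S y)‖ + ‖u (S y) - z * u y‖ + ‖z * (u y - ζ y)‖ := norm_add₃_le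
      _ < c := by linarith
  have hiter : ∀ k, ζ (S^[k] x) = z ^ k * ζ x := fun k => by
    induction k with
    | zero => simp
    | succ k ih => rw [Function.iterate_succ_apply', hstep, ih, pow_succ']; ring
  -- At a sufficiently close return to `x` the rounded value is unchanged, while iteration
  -- multiplied it by `z ^ N n`; so that power is `1`.
  obtain ⟨n, hn⟩ := ((((u.continuous.tendsto x).comp hN).sub_const (u x)).norm.eventually_lt_const
    (show ‖u x - u x‖ < c / 3 by simpa using hη)).exists
  refine ⟨n, (hz.pow_eq_one_iff_dvd _).1 ?_⟩
  have h3 : ‖ζ (S^[N n] x) - u (S^[N n] x)‖ < c / 3 := by rw [norm_sub_rev]; exact hζ2 _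
  have heq : ζ (S^[N n] x) = ζ x := by
    refine hgap _ _ (hζ1 _) (hζ1 _) ?_
    calc ‖ζ (S^[N n] x) - ζ x‖
        = ‖(ζ (S^[N n] x) - u (S^[N n] x)) + (u (S^[N n] x) - u x) + (u x - ζ x)‖ := by ring_nf
      _ ≤ ‖ζ (S^[N n] x) - u (S^[N n] x)‖ + ‖u (S^[N n] x) - u x‖ + ‖u x - ζ x‖ := norm_add₃_le
      _ < c := by linarith [hζ2 x, show ‖u (S^[N n] x) - u x‖ < c / 3 from hn]
  have hne : ζ x ≠ 0 := fun h0 => by simpa [h0, hd.ne'] using hζ1 x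
  exact mul_right_cancel₀ hne (by rw [← hiter, heq, one_mul])

/-! ### Residues of points of an odometer -/

/-- The product of the first `n` bases. -/
def baseProd (a : ℕ → ℕ) (n : ℕ) : ℕ := ∏ i ∈ range n, a i

/-- The natural number whose digits are the first `n` digits of `b`. -/
def digitSum {a : ℕ → ℕ} (b : ∀ n, Fin (a n)) (n : ℕ) : ℕ :=
  ∑ i ∈ range n, baseProd a i * (b i : ℕ)

section Digits

variable {a : ℕ → ℕ}

theorem baseProd_succ (n : ℕ) : baseProd a (n + 1) = baseProd a n * a n :=
  prod_range_succ _ _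

theorem digitSum_succ (b : ∀ n, Fin (a n)) (n : ℕ) :
    digitSum b (n + 1) = digitSum b n + baseProd a n * (b n : ℕ) :=
  sum_range_succ _ _

theorem baseProd_dvd {m n : ℕ} (h : m ≤ n) : baseProd a m ∣ baseProd a n :=
  prod_dvd_prod_of_subset _ _ _ (range_mono h)

theorem baseProd_pos (ha : ∀ n, 0 < a n) (n : ℕ) : 0 < baseProd a n :=
  prod_pos fun i _ => ha i

theorem digitSum_lt (b : ∀ n, Fin (a n)) (n : ℕ) : digitSum b n < baseProd a n := by
  induction n with
  | zero => simp [digitSum, baseProd]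
  | succ n ih =>
    rw [digitSum_succ, baseProd_succ]
    calc digitSum b n + baseProd a n * (b n : ℕ)
        < baseProd a n + baseProd a n * (b n : ℕ) := by omega
      _ = baseProd a n * ((b n : ℕ) + 1) := by ring
      _ ≤ _ := Nat.mul_le_mul_left _ (b n).isLt

theorem digitSum_modEq (b : ∀ n, Fin (a n)) {m n : ℕ} (h : m ≤ n) :
    digitSum b n ≡ digitSum b m [MOD baseProd a m] := by
  induction n, h using Nat.le_induction with
  | base => rfl
  | succ n hmn ih =>
    rw [digitSum_succ]
    simpa using ih.add ((Nat.modEq_zero_iff_dvd.2 ((baseProd_dvd hmn).mul_right (b n : ℕ))))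

theorem digitSum_succ_div (b : ∀ n, Fin (a n)) (n : ℕ) :
    digitSum b (n + 1) / baseProd a n = b n := by
  have hlt := digitSum_lt b n
  rw [digitSum_succ, Nat.add_mul_div_left _ _ (by omega), Nat.div_eq_of_lt hlt, zero_add]

/-- The exact count in `ℕ`, without subtraction: a carry leaving the first `n` digits loses
precisely `baseProd a n`. -/
theorem digitSum_odometerMap_add (b : ∀ n, Fin (a n)) (n : ℕ) :
    digitSum (odometerMap a b) n + (if ∀ j < n, (b j : ℕ) + 1 = a j then baseProd a n else 0) =
      digitSum b n + 1 := by
  induction n with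
  | zero => simp [digitSum, baseProd]
  | succ n ih =>
    rw [digitSum_succ, digitSum_succ, baseProd_succ]
    have hiff : (∀ j < n + 1, (b j : ℕ) + 1 = a j) ↔
        (∀ j < n, (b j : ℕ) + 1 = a j) ∧ (b n : ℕ) + 1 = a n := Nat.forall_lt_succ_right
    by_cases h : ∀ j < n, (b j : ℕ) + 1 = a j
    · rw [if_pos h] at ih
      by_cases hn : (b n : ℕ) + 1 = a n
      · have hval : (odometerMap a b n : ℕ) = 0 := by simp [odometerMap, if_pos h, hn]
        have hmul : baseProd a n * a n = baseProd a n * (b n : ℕ) + baseProd a n := by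
          rw [← mul_add_one, hn]
        rw [if_pos (hiff.2 ⟨h, hn⟩), hval, hmul]
        omega
      · have hlt : (b n : ℕ) + 1 < a n := lt_of_le_of_ne (b n).isLt hn
        have hval : (odometerMap a b n : ℕ) = b n + 1 := by
          rw [odometerMap_of_first h hlt]; simp
        rw [if_neg fun H => hn (hiff.1 H).2, hval, mul_add]
        omega
    · have hval : (odometerMap a b n : ℕ) = b n := by simp only [odometerMap]; rw [if_neg h]
      rw [if_neg h] at ih
      rw [if_neg fun H => h (hiff.1 H).1, hval]
      omega

theorem digitSum_odometerMap (b : ∀ n, Fin (a n)) (n : ℕ) :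
    digitSum (odometerMap a b) n ≡ digitSum b n + 1 [MOD baseProd a n] := by
  rw [← digitSum_odometerMap_add]
  split_ifs
  · exact (Nat.add_modEq_right).symm
  · rfl

theorem digitSum_iterate (b : ∀ n, Fin (a n)) (n k : ℕ) :
    digitSum ((odometerMap a)^[k] b) n ≡ digitSum b n + k [MOD baseProd a n] := by
  induction k with
  | zero => rfl
  | succ k ih =>
    rw [Function.iterate_succ_apply']
    exact (digitSum_odometerMap _ n).trans (ih.add_right 1)

theorem eq_of_digitSum_modEq {b c : ∀ n, Fin (a n)} {n : ℕ}
    (h : digitSum b (n + 1) ≡ digitSum c (n + 1) [MOD baseProd a (n + 1)]) : b n = c n := by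
  have := h.eq_of_lt_of_lt (digitSum_lt b _) (digitSum_lt c _)
  exact Fin.ext (by rw [← digitSum_succ_div b, ← digitSum_succ_div c, this])

theorem continuous_digitSum (n : ℕ) :
    Continuous fun b : (∀ n, Fin (a n)) => digitSum b n :=
  continuous_finsetSum _ fun i _ => (continuous_of_discreteTopology
    (f := fun j : Fin (a i) => baseProd a i * (j : ℕ))).comp (continuous_apply i)

/-- Adding `baseProd a n` leaves the first `n` digits fixed, so each coordinate is eventually
constant. -/
theorem tendsto_iterate_baseProd (b : ∀ n, Fin (a n)) :
    Tendsto (fun n => (odometerMap a)^[baseProd a n] b) atTop (𝓝 b) := by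
  refine tendsto_pi_nhds.2 fun k => tendsto_const_nhds.congr' ?_
  filter_upwards [eventually_ge_atTop (k + 1)] with n hn
  refine (eq_of_digitSum_modEq (((digitSum_iterate b (k + 1) _).trans ?_))).symm
  simpa using (Nat.ModEq.refl (digitSum b (k + 1))).add
    (Nat.modEq_zero_iff_dvd.2 (baseProd_dvd (a := a) hn))

/-! ### Residues modulo the divisors of the partial products -/

/-- The divisors of the supernatural number `∏ aₙ`. -/
def divisorSet (a : ℕ → ℕ) : Set ℕ := {d | ∃ n, d ∣ baseProd a n}

open Classical in
/-- The residues of `b` modulo the elements of `divisorSet a`, and `0` at all other places. -/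
noncomputable def residues (b : ∀ n, Fin (a n)) (d : ℕ) : ℕ :=
  if h : ∃ n, d ∣ baseProd a n then digitSum b h.choose % d else 0

theorem residues_of_dvd (b : ∀ n, Fin (a n)) {d n : ℕ} (h : d ∣ baseProd a n) :
    residues b d = digitSum b n % d := by
  have hex : ∃ n, d ∣ baseProd a n := ⟨n, h⟩
  rw [residues, dif_pos hex]
  rcases le_total n hex.choose with hle | hle
  · exact (digitSum_modEq b hle).of_dvd h
  · exact ((digitSum_modEq b hle).of_dvd hex.choose_spec).symm

theorem residues_of_notMem (b : ∀ n, Fin (a n)) {d : ℕ} (h : d ∉ divisorSet a) :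
    residues b d = 0 := dif_neg h

theorem residues_baseProd (b : ∀ n, Fin (a n)) (n : ℕ) :
    residues b (baseProd a n) = digitSum b n := by
  rw [residues_of_dvd b dvd_rfl, Nat.mod_eq_of_lt (digitSum_lt b n)]

theorem continuous_residues : Continuous (residues : (∀ n, Fin (a n)) → ℕ → ℕ) := by
  refine continuous_pi fun d => ?_
  by_cases hd : d ∈ divisorSet a
  · obtain ⟨n, hn⟩ := hd
    simp only [residues_of_dvd _ hn]
    exact (continuous_of_discreteTopology (f := fun k : ℕ => k % d)).comp (continuous_digitSum n)
  · simp only [residues_of_notMem _ hd]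
    exact continuous_const

theorem injective_residues : Function.Injective (residues : (∀ n, Fin (a n)) → ℕ → ℕ) :=
  fun b c h => funext fun n => eq_of_digitSum_modEq (by
    rw [← residues_baseProd b, ← residues_baseProd c, h])

/-- Coherent families of residues modulo the elements of `D`, extended by `0`. -/
def coherentResidues (D : Set ℕ) : Set (ℕ → ℕ) :=
  {f | (∀ d ∉ D, f d = 0) ∧ (∀ d ∈ D, f d < d) ∧ ∀ d ∈ D, ∀ e ∈ D, d ∣ e → f e % d = f d}

/-- The partial products are cofinal for divisibility in `divisorSet a`, so a coherent family is
determined by its values there, and these are the digit sums of a point. -/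
theorem range_residues (ha : ∀ n, 0 < a n) :
    Set.range (residues : (∀ n, Fin (a n)) → ℕ → ℕ) = coherentResidues (divisorSet a) := by
  refine Set.Subset.antisymm ?_ fun f hf => ?_
  · rintro _ ⟨b, rfl⟩
    refine ⟨fun d => residues_of_notMem b, ?_, ?_⟩
    · rintro d ⟨n, hn⟩
      rw [residues_of_dvd b hn]
      exact Nat.mod_lt _ (Nat.pos_of_dvd_of_pos hn (baseProd_pos ha n))
    · rintro d - e ⟨n, hn⟩ hde
      rw [residues_of_dvd b hn, residues_of_dvd b (hde.trans hn), Nat.mod_mod_of_dvd _ hde]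
  · obtain ⟨hf0, hflt, hfc⟩ := hf
    have hmem : ∀ n, baseProd a n ∈ divisorSet a := fun n => ⟨n, dvd_rfl⟩
    let b : ∀ n, Fin (a n) := fun n => ⟨f (baseProd a (n + 1)) / baseProd a n,
      Nat.div_lt_of_lt_mul (by rw [← baseProd_succ]; exact hflt _ (hmem _))⟩
    have hb : ∀ n, digitSum b n = f (baseProd a n) := fun n => by
      induction n with
      | zero =>
        have := hflt _ (hmem 0)
        -- The empty product is `1`, and a residue below `1` is `0`.
        simp only [baseProd, digitSum, range_zero, prod_empty, sum_empty] at this ⊢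
        omega
      | succ n ih =>
        rw [digitSum_succ, ih, ← hfc _ (hmem n) _ (hmem (n + 1)) (baseProd_dvd n.le_succ)]
        exact Nat.mod_add_div _ _
    refine ⟨b, funext fun d => ?_⟩
    by_cases hd : d ∈ divisorSet a
    · obtain ⟨n, hn⟩ := hd
      rw [residues_of_dvd b hn, hb, hfc d ⟨n, hn⟩ _ (hmem n) hn]
    · rw [residues_of_notMem b hd, hf0 d hd]

open Classical in
/-- Addition of `1` on families of residues modulo the elements of `D`. -/
noncomputable def residuesSucc (D : Set ℕ) (f : ℕ → ℕ) (d : ℕ) : ℕ := if d ∈ D then (f d + 1) % d else 0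

theorem residues_odometerMap (b : ∀ n, Fin (a n)) :
    residues (odometerMap a b) = residuesSucc (divisorSet a) (residues b) := by
  funext d
  by_cases hd : d ∈ divisorSet a
  · rw [residuesSucc, if_pos hd]
    obtain ⟨n, hn⟩ := hd
    rw [residues_of_dvd _ hn, residues_of_dvd _ hn, Nat.mod_add_mod]
    exact (digitSum_odometerMap b n).of_dvd hn
  · rw [residuesSucc, if_neg hd, residues_of_notMem _ hd]

end Digits

/-! ### Invariants of odometers -/

/-- Systems that embed in the same map with the same range are conjugate. -/
theorem TopConjugate.of_range_eq {X Y Z : Type*} [TopologicalSpace X] [CompactSpace X]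
    [TopologicalSpace Y] [CompactSpace Y] [TopologicalSpace Z] [T2Space Z]
    {S : X ≃ₜ X} {T : Y ≃ₜ Y} {F : X → Z} {G : Y → Z} (R : Z → Z)
    (hF : Continuous F) (hG : Continuous G) (hFi : Function.Injective F)
    (hGi : Function.Injective G) (hFS : ∀ x, F (S x) = R (F x)) (hGT : ∀ y, G (T y) = R (G y))
    (hrange : Set.range F = Set.range G) : TopConjugate S T := by
  have hFe := (hF.isClosedEmbedding hFi).isEmbedding
  have hGe := (hG.isClosedEmbedding hGi).isEmbedding
  let h : X ≃ₜ Y := (hFe.toHomeomorph.trans (Homeomorph.setCongr hrange)).trans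
    hGe.toHomeomorph.symm
  have hh : ∀ x, G (h x) = F x := fun x =>
    congrArg Subtype.val (hGe.toHomeomorph.apply_symm_apply
      (Homeomorph.setCongr hrange (hFe.toHomeomorph x)))
  exact ⟨h, fun x => hGi (by rw [hh, hFS, hGT, hh])⟩

section Odometer

variable {X : Type*} [TopologicalSpace X] [CompactSpace X] {S : X ≃ₜ X} {a : ℕ → ℕ}
  {h : X ≃ₜ ∀ n, Fin (a n)}

theorem eval_eigenvalueSentence_of_mem_divisorSet (hS : ∀ x, h (S x) = odometerMap a (h x))
    {d : ℕ} {z : ℂ} (hz : z ^ d = 1) (hz1 : ‖z‖ = 1) (hd : d ∈ divisorSet a) :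
    (eigenvalueSentence d z).eval (inducedAut S) Fin.elim0 = 0 := by
  obtain ⟨n, hn⟩ := hd
  let u : C(X, ℂ) := ⟨fun x => z ^ digitSum (h x) n,
    (continuous_of_discreteTopology (f := fun k : ℕ => z ^ k)).comp
      ((continuous_digitSum n).comp h.continuous)⟩
  have hu : ∀ x, u x = z ^ digitSum (h x) n := fun _ => rfl
  refine eval_eigenvalueSentence_eq_zero (u := u) ?_ ?_ ?_
  · exact (ContinuousMap.norm_le _ zero_le_one).2 fun x => by rw [hu, norm_pow, hz1, one_pow]
  · ext x
    rw [ContinuousMap.pow_apply, hu, pow_right_comm, hz, one_pow, ContinuousMap.one_apply]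
  · ext x
    rw [inducedAut_apply, ContinuousMap.smul_apply, hu, hu, hS, smul_eq_mul, ← pow_succ']
    exact pow_eq_pow_of_modEq ((digitSum_odometerMap (h x) n).of_dvd hn) hz

theorem mem_divisorSet_of_eval_eigenvalueSentence (ha : ∀ n, 0 < a n)
    (hS : ∀ x, h (S x) = odometerMap a (h x)) {d : ℕ} (hd : 0 < d) {z : ℂ}
    (hz : IsPrimitiveRoot z d)
    (hev : (eigenvalueSentence d z).eval (inducedAut S) Fin.elim0 = 0) : d ∈ divisorSet a := by
  refine exists_dvd_of_eval_eigenvalueSentence hd hz hev (x := h.symm fun n => ⟨0, ha n⟩) ?_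
  -- Recurrence holds at every point of the digit space; it is transported to `X` from the zero
  -- sequence.
  have hsemi : Function.Semiconj h.symm (odometerMap a) S := fun b => by
    rw [h.symm_apply_eq, hS, h.apply_symm_apply]
  simp only [← hsemi.iterate_right _ _]
  exact (h.symm.continuous.tendsto _).comp (tendsto_iterate_baseProd _)

end Odometer

/-! ### Recovering the odometer from its theory -/

theorem divisorSet_subset_of_elementarilyEquivalent {X Y : Type*} [TopologicalSpace X]
    [CompactSpace X] [TopologicalSpace Y] [CompactSpace Y] {S : X ≃ₜ X} {T : Y ≃ₜ Y}
    {a a' : ℕ → ℕ} {h : X ≃ₜ ∀ n, Fin (a n)} {k : Y ≃ₜ ∀ n, Fin (a' n)}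
    (ha : ∀ n, 0 < a n) (ha' : ∀ n, 0 < a' n) (hS : ∀ x, h (S x) = odometerMap a (h x))
    (hT : ∀ y, k (T y) = odometerMap a' (k y))
    (hST : ElementarilyEquivalent (inducedAut S) (inducedAut T)) :
    divisorSet a ⊆ divisorSet a' := by
  intro d hd
  have hpos : 0 < d := hd.elim fun n hn => Nat.pos_of_dvd_of_pos hn (baseProd_pos ha n)
  have hz := Complex.isPrimitiveRoot_exp d hpos.ne'
  refine mem_divisorSet_of_eval_eigenvalueSentence ha' hT hpos hz ?_
  rw [← hST]
  exact eval_eigenvalueSentence_of_mem_divisorSet hS hz.pow_eq_one (hz.norm'_eq_one hpos.ne') hd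

theorem ElementarilyEquivalent.topConjugate {X Y : Type*} [TopologicalSpace X]
    [CompactSpace X] [TopologicalSpace Y] [CompactSpace Y] {S : X ≃ₜ X} {T : Y ≃ₜ Y}
    (hS : IsOdometer S) (hT : IsOdometer T)
    (hST : ElementarilyEquivalent (inducedAut S) (inducedAut T)) : TopConjugate S T := by
  obtain ⟨a, ha, h, hh⟩ := hS
  obtain ⟨a', ha', k, hk⟩ := hT
  have hpos : ∀ n, 0 < a n := fun n => zero_lt_two.trans_le (ha n)
  have hpos' : ∀ n, 0 < a' n := fun n => zero_lt_two.trans_le (ha' n)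
  have hD : divisorSet a = divisorSet a' :=
    (divisorSet_subset_of_elementarilyEquivalent hpos hpos' hh hk hST).antisymm
      (divisorSet_subset_of_elementarilyEquivalent hpos' hpos hk hh fun φ => (hST φ).symm)
  refine .of_range_eq (F := residues ∘ h) (G := residues ∘ k) (residuesSucc (divisorSet a))
    (continuous_residues.comp h.continuous) (continuous_residues.comp k.continuous)
    (injective_residues.comp h.injective) (injective_residues.comp k.injective)
    (fun x => ?_) (fun y => ?_) ?_
  · simp only [Function.comp_apply, hh, residues_odometerMap]
  · simp only [Function.comp_apply, hk, residues_odometerMap, hD]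
  · rw [h.surjective.range_comp, k.surjective.range_comp, range_residues hpos,
      range_residues hpos', hD]

end CStarDyn

theorem theorem2p5 {X : Type*} {Y : Type*} [TopologicalSpace X] [CompactSpace X]
    [TopologicalSpace Y] [CompactSpace Y] (S : X ≃ₜ X) (T : Y ≃ₜ Y)
    (hS : CStarDyn.IsOdometer S) (hT : CStarDyn.IsOdometer T) :
    (CStarDyn.ElementarilyEquivalent (CStarDyn.inducedAut S) (CStarDyn.inducedAut T) ↔
      CStarDyn.Isomorphic (CStarDyn.inducedAut S) (CStarDyn.inducedAut T)) ∧
    (CStarDyn.ElementarilyEquivalent (CStarDyn.inducedAut S) (CStarDyn.inducedAut T) ↔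
      CStarDyn.TopConjugate S T) := by
  have hconj := CStarDyn.ElementarilyEquivalent.topConjugate hS hT
  exact ⟨⟨fun h => (hconj h).isomorphic, fun h => h.elementarilyEquivalent⟩,
    hconj, fun h => h.isomorphic.elementarilyEquivalent⟩
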